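/- For integers $n,k,\ell \ge 0$ let $N(n,k,\ell)$ be the maximum number of $k$-vertex subsets of an $n$-vertex graph that induce exactly $\ell$ edges, and let $$\mathrm{ind}(k,\ell)=\lim_{n\to\infty}\frac{N(n,k,\ell)}{\binom nk}$$ (the sequence is non-increasing for $n\ge k$, so the limit exists). For $p\in[0,1]$ and a polynomial $f$ with real coefficients in $s$ variables, write $f(\vec\xi(p))$ for $f(\xi_1,\dots,\xi_s)$, where $\xi_1,\dots,\xi_s$ are independent $\mathrm{Ber}(p)$ random variables. **Lemma.** Fix any $p\in(0,1/2]$. There is a constant $C$, depending only on $p$, such that for all integers $k,\ell$ with $1\le \ell\le k$, $$\mathrm{ind}(k,\ell)\;\le\;\sup_f\,\mathbb P\big[f(\vec\xi(p))=\ell\big]+C\cdot\frac{\ell\log k+\log^2 k}{k},$$ where $\log$ is the natural logarithm and the supremum is over all homogeneous multilinear quadratic polynomials $f$ with coefficients in $\{0,1\}$, in any finite number of variables. -/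

import Mathlib

open Filter Topology MeasureTheory

/-- The number of edges `e(G[S])` of the subgraph of `G` induced by the vertex set `S`. -/
noncomputable def inducedEdges {V : Type*} (G : SimpleGraph V) (S : Finset V) : ℕ :=
  (G.induce (S : Set V)).edgeSet.ncard

open scoped Classical in
/-- The `k`-vertex subsets of the vertex set of `G` that induce exactly `ℓ` edges. -/
noncomputable def edgeStatSets {n : ℕ} (G : SimpleGraph (Fin n)) (k ℓ : ℕ) :
    Finset (Finset (Fin n)) :=
  (Finset.powersetCard k Finset.univ).filter fun S => inducedEdges G S = ℓ

/-- `N(n, k, ℓ)`: the maximum, over all graphs on `n` vertices, of the number of `k`-vertex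
subsets that induce exactly `ℓ` edges. -/
noncomputable def maxEdgeStat (n k ℓ : ℕ) : ℕ :=
  (Finset.univ : Finset (SimpleGraph (Fin n))).sup fun G => (edgeStatSets G k ℓ).card

/-- The edge-inducibility `ind(k, ℓ) = lim_{n → ∞} N(n, k, ℓ) / (n choose k)`.
The limit exists, see `tendsto_edgeInducibility` below. -/
noncomputable def edgeInducibility (k ℓ : ℕ) : ℝ :=
  limUnder atTop fun n : ℕ => (maxEdgeStat n k ℓ : ℝ) / (n.choose k : ℝ)

theorem inducedEdges_map {V W : Type*} (G : SimpleGraph W) (f : V ↪ W) (T : Finset V) :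
    inducedEdges G (T.map f) = inducedEdges (G.comap f) T := by
  unfold inducedEdges
  let e : (G.comap f).induce (T : Set V) ≃g G.induce ((T.map f : Finset W) : Set W) :=
    { toEquiv := (Equiv.Set.image f (T : Set V) f.injective).trans
        (Equiv.setCongr (Finset.coe_map f T).symm)
      map_rel_iff' := by
        intro a b
        exact Iff.rfl }
  exact (Nat.card_congr e.mapEdgeSet).symm

theorem card_edgeStatSets_le {n k ℓ : ℕ} (G : SimpleGraph (Fin n)) :
    (edgeStatSets G k ℓ).card ≤ maxEdgeStat n k ℓ :=
  Finset.le_sup (f := fun G : SimpleGraph (Fin n) => (edgeStatSets G k ℓ).card)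
    (Finset.mem_univ G)

theorem maxEdgeStat_succ_mul_le (n k ℓ : ℕ) :
    maxEdgeStat (n + 1) k ℓ * (n + 1 - k) ≤ (n + 1) * maxEdgeStat n k ℓ := by
  classical
  obtain ⟨G, -, hG⟩ := Finset.exists_mem_eq_sup (Finset.univ : Finset (SimpleGraph (Fin (n + 1))))
    Finset.univ_nonempty fun G => (edgeStatSets G k ℓ).card
  have hN : maxEdgeStat (n + 1) k ℓ = (edgeStatSets G k ℓ).card := hG
  have hcount : ∑ v : Fin (n + 1), ((edgeStatSets G k ℓ).filter fun S => v ∉ S).card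
      = (edgeStatSets G k ℓ).card * (n + 1 - k) := by
    simp_rw [Finset.card_filter]
    rw [Finset.sum_comm, ← smul_eq_mul, ← Finset.sum_const]
    refine Finset.sum_congr rfl fun S hS => ?_
    have hc : S.card = k := by
      simp only [edgeStatSets, Finset.mem_filter, Finset.mem_powersetCard] at hS
      exact hS.1.2
    rw [← Finset.card_filter]
    have : (Finset.univ.filter fun v => v ∉ S) = Sᶜ := by ext v; simp
    rw [this, Finset.card_compl, Fintype.card_fin, hc]
  rw [hN, ← hcount]
  calc ∑ v : Fin (n + 1), ((edgeStatSets G k ℓ).filter fun S => v ∉ S).card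
      ≤ ∑ _v : Fin (n + 1), maxEdgeStat n k ℓ := by
        refine Finset.sum_le_sum fun v _ => ?_
        refine le_trans ?_ (card_edgeStatSets_le (G.comap (Fin.succAboveEmb v)))
        refine le_trans (Finset.card_le_card (t := (edgeStatSets (G.comap (Fin.succAboveEmb v))
          k ℓ).image fun T => T.map (Fin.succAboveEmb v)) ?_) Finset.card_image_le
        intro S hS
        simp only [edgeStatSets, Finset.mem_filter, Finset.mem_powersetCard] at hS
        obtain ⟨⟨⟨-, hk⟩, hl⟩, hv⟩ := hS
        have hSmap : (Finset.univ.filter fun i => v.succAbove i ∈ S).map (Fin.succAboveEmb v)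
            = S := by
          ext w
          simp only [Finset.mem_map, Finset.mem_filter, Finset.mem_univ, true_and,
            Fin.succAboveEmb_apply]
          constructor
          · rintro ⟨i, hi, rfl⟩
            exact hi
          · intro hw
            have hne : w ≠ v := fun h => hv (h ▸ hw)
            obtain ⟨i, rfl⟩ := Fin.exists_succAbove_eq hne
            exact ⟨i, hw, rfl⟩
        refine Finset.mem_image.2 ⟨_, ?_, hSmap⟩
        simp only [edgeStatSets, Finset.mem_filter, Finset.mem_powersetCard]
        refine ⟨⟨Finset.subset_univ _, ?_⟩, ?_⟩
        · rw [← hk]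
          conv_rhs => rw [← hSmap]
          rw [Finset.card_map]
        · rw [← inducedEdges_map, hSmap, hl]
    _ = (n + 1) * maxEdgeStat n k ℓ := by simp

/-- The sequence `N(n, k, ℓ) / (n choose k)` is non-increasing for `n ≥ k`. -/
theorem maxEdgeStat_div_choose_succ_le {n k : ℕ} (ℓ : ℕ) (hn : k ≤ n) :
    (maxEdgeStat (n + 1) k ℓ : ℝ) / ((n + 1).choose k : ℝ)
      ≤ (maxEdgeStat n k ℓ : ℝ) / (n.choose k : ℝ) := by
  have h1 := maxEdgeStat_succ_mul_le n k ℓ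
  have h2 := Nat.choose_mul_succ_eq n k
  have c1 : 0 < n.choose k := Nat.choose_pos hn
  have c2 : 0 < (n + 1).choose k := Nat.choose_pos (by omega)
  have hpos : 0 < n + 1 - k := by omega
  rw [div_le_div_iff₀ (by exact_mod_cast c2) (by exact_mod_cast c1)]
  have : maxEdgeStat (n + 1) k ℓ * n.choose k * (n + 1)
      ≤ maxEdgeStat n k ℓ * (n + 1).choose k * (n + 1) := by
    calc maxEdgeStat (n + 1) k ℓ * n.choose k * (n + 1)
        = (maxEdgeStat (n + 1) k ℓ * (n + 1 - k)) * (n + 1).choose k := by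
          rw [mul_assoc, h2]; ring
      _ ≤ ((n + 1) * maxEdgeStat n k ℓ) * (n + 1).choose k := Nat.mul_le_mul_right _ h1
      _ = _ := by ring
  exact_mod_cast Nat.le_of_mul_le_mul_right this (Nat.succ_pos n)

/-- The limit defining the edge-inducibility exists. -/
theorem tendsto_edgeInducibility (k ℓ : ℕ) :
    Tendsto (fun n : ℕ => (maxEdgeStat n k ℓ : ℝ) / (n.choose k : ℝ)) atTop
      (𝓝 (edgeInducibility k ℓ)) := by
  apply tendsto_nhds_limUnder
  have hanti : Antitone fun m : ℕ =>
      (maxEdgeStat (m + k) k ℓ : ℝ) / ((m + k).choose k : ℝ) :=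
    antitone_nat_of_succ_le fun m => by
      have := maxEdgeStat_div_choose_succ_le (n := m + k) (k := k) ℓ (by omega)
      rwa [show m + 1 + k = m + k + 1 by omega]
  have hbdd : BddBelow (Set.range fun m : ℕ =>
      (maxEdgeStat (m + k) k ℓ : ℝ) / ((m + k).choose k : ℝ)) :=
    ⟨0, by rintro _ ⟨m, rfl⟩; positivity⟩
  exact ⟨_, (tendsto_add_atTop_iff_nat k).1 (tendsto_atTop_ciInf hanti hbdd)⟩

/-- `f` is a homogeneous multilinear quadratic polynomial with coefficients in `{0, 1}`:
a sum of distinct monomials `x_i x_j` with `i ≠ j`. -/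
structure IsZeroOneQuadratic {s : ℕ} (f : MvPolynomial (Fin s) ℝ) : Prop where
  homogeneous : f.IsHomogeneous 2
  multilinear : ∀ i, f.degreeOf i ≤ 1
  coeff_mem : ∀ m, f.coeff m = 0 ∨ f.coeff m = 1

/-- The law of a vector `(ξ_1, …, ξ_s)` of independent `Ber(p)` random variables. -/
noncomputable def bernoulliVector (s : ℕ) (p : unitInterval) : Measure (Fin s → ℝ) :=
  Measure.pi fun _ => ProbabilityTheory.bernoulliMeasure (1 : ℝ) 0 p

/-- The probability that `f(ξ_1, …, ξ_s) = ℓ` for independent `Ber(p)` variables `ξ_i`. -/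
noncomputable def bernoulliPointProb {s : ℕ} (f : MvPolynomial (Fin s) ℝ) (p : unitInterval)
    (ℓ : ℕ) : ℝ :=
  (bernoulliVector s p).real {x | MvPolynomial.eval x f = (ℓ : ℝ)}

/-- The set of all values of `P[f(ξ(p)) = ℓ]`, where `f` ranges over the homogeneous multilinear
quadratic polynomials with coefficients in `{0, 1}`, in any finite number of variables. -/
def bernoulliPointProbs (p : unitInterval) (ℓ : ℕ) : Set ℝ :=
  {x | ∃ (s : ℕ) (f : MvPolynomial (Fin s) ℝ), IsZeroOneQuadratic f ∧
    x = bernoulliPointProb f p ℓ}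

theorem bernoulliPointProbs_nonempty (p : unitInterval) (ℓ : ℕ) :
    (bernoulliPointProbs p ℓ).Nonempty :=
  ⟨_, 0, 0, ⟨MvPolynomial.isHomogeneous_zero _ _ _, by simp, by simp⟩, rfl⟩

theorem bernoulliPointProbs_bddAbove (p : unitInterval) (ℓ : ℕ) :
    BddAbove (bernoulliPointProbs p ℓ) := by
  refine ⟨1, ?_⟩
  rintro _ ⟨s, f, -, rfl⟩
  unfold bernoulliPointProb bernoulliVector
  exact measureReal_le_one

/-! ### The binomial point probabilities -/

/-- The probability that a `Bin(n, p)` variable equals `m`. -/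
noncomputable def binomialMass (p : ℝ) (n m : ℕ) : ℝ :=
  n.choose m * p ^ m * (1 - p) ^ (n - m)

theorem binomialMass_nonneg {p : ℝ} (hp0 : 0 ≤ p) (hp1 : p ≤ 1) (n m : ℕ) :
    0 ≤ binomialMass p n m := by
  have : 0 ≤ 1 - p := by linarith
  unfold binomialMass
  positivity

theorem binomialMass_eq_zero {p : ℝ} {n m : ℕ} (h : n < m) : binomialMass p n m = 0 := by
  simp [binomialMass, Nat.choose_eq_zero_of_lt h]

theorem sum_binomialMass (p : ℝ) (n : ℕ) :
    ∑ m ∈ Finset.range (n + 1), binomialMass p n m = 1 := by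
  have := add_pow p (1 - p) n
  rw [add_sub_cancel, one_pow] at this
  rw [this]
  refine Finset.sum_congr rfl fun m _ => ?_
  unfold binomialMass
  ring

theorem binomialMass_succ_left (p : ℝ) {n m : ℕ} (h : m ≤ n) :
    binomialMass p n m * (1 - p) * (n + 1) = binomialMass p (n + 1) m * (n + 1 - m) := by
  have h1 : (n.choose m : ℝ) * (n + 1) = (n + 1).choose m * (n + 1 - m) := by
    have := Nat.choose_mul_succ_eq n m
    rw [← Nat.cast_inj (R := ℝ)] at this
    push_cast [Nat.cast_sub (show m ≤ n + 1 by omega)] at this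
    exact this
  unfold binomialMass
  rw [show n + 1 - m = (n - m) + 1 by omega, pow_succ]
  linear_combination p ^ m * (1 - p) ^ (n - m) * (1 - p) * h1

theorem binomialMass_succ_succ (p : ℝ) (n m : ℕ) :
    binomialMass p n m * p * (n + 1) = binomialMass p (n + 1) (m + 1) * (m + 1) := by
  have h1 : ((n : ℝ) + 1) * n.choose m = (n + 1).choose (m + 1) * (m + 1) := by
    exact_mod_cast Nat.add_one_mul_choose_eq n m
  unfold binomialMass
  rw [show n + 1 - (m + 1) = n - m by omega, pow_succ]
  linear_combination p ^ m * (1 - p) ^ (n - m) * p * h1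

theorem binomialMass_succ_right (p : ℝ) {n m : ℕ} (h : m < n) :
    binomialMass p n (m + 1) * (m + 1) * (1 - p) = binomialMass p n m * (n - m) * p := by
  obtain ⟨n, rfl⟩ : ∃ r, n = r + 1 := ⟨n - 1, by omega⟩
  have h1 := binomialMass_succ_left p (show m ≤ n by omega)
  have h2 := binomialMass_succ_succ p n m
  push_cast
  linear_combination p * h1 - (1 - p) * h2

theorem binomialMass_le_of_succ {p : ℝ} (hp0 : 0 < p) (hp : p ≤ 1 / 2) {n : ℕ} {M : ℝ}
    (hM : ∀ m, binomialMass p (n + 1) m ≤ M) (m : ℕ) :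
    binomialMass p n m * (n + 1) ≤ M * (n + 3) := by
  have hM0 : 0 ≤ M := (binomialMass_nonneg hp0.le (by linarith) _ 0).trans (hM 0)
  rcases lt_or_ge n m with h | h
  · rw [binomialMass_eq_zero h, zero_mul]
    positivity
  rcases le_or_gt ((m : ℝ) + 1) ((n + 1) * p) with h' | h'
  · have h1 := binomialMass_succ_succ p n m
    have h2 : binomialMass p (n + 1) (m + 1) * (m + 1) ≤ M * ((n + 1) * p) :=
      mul_le_mul (hM _) h' (by positivity) hM0
    have h3 : p * (binomialMass p n m * (n + 1)) ≤ p * (M * (n + 1)) := by linarith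
    have h4 := le_of_mul_le_mul_left h3 hp0
    linarith
  · have h1 := binomialMass_succ_left p h
    have hmn : (m : ℝ) ≤ n := by exact_mod_cast h
    have h2 : binomialMass p (n + 1) m * (n + 1 - m) ≤ M * ((n + 1) * (1 - p) + 1) :=
      mul_le_mul (hM _) (by linarith) (by linarith) hM0
    have h3 : (1 - p) * (binomialMass p n m * (n + 1)) ≤ (1 - p) * (M * (n + 3)) := by
      have : M * 1 ≤ M * ((1 - p) * 2) := mul_le_mul_of_nonneg_left (by linarith) hM0
      linarith
    exact le_of_mul_le_mul_left h3 (by linarith)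

theorem binomialMass_le_of_add {p : ℝ} (hp0 : 0 < p) (hp : p ≤ 1 / 2) {n : ℕ} (t : ℕ) {M : ℝ}
    (hM : ∀ m, binomialMass p (n + t) m ≤ M) (m : ℕ) :
    binomialMass p n m * ((n + 1) * (n + 2)) ≤ M * ((n + t + 1) * (n + t + 2)) := by
  induction t generalizing M with
  | zero =>
    simp only [CharP.cast_eq_zero, add_zero] at *
    exact mul_le_mul_of_nonneg_right (hM m) (by positivity)
  | succ t ih =>
    have h := binomialMass_le_of_succ hp0 hp (n := n + t) hM
    have h' := ih (M := M * ((n + t : ℕ) + 3) / ((n + t : ℕ) + 1)) fun m => by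
      rw [le_div_iff₀ (by positivity)]
      exact h m
    refine h'.trans (le_of_eq ?_)
    push_cast
    field_simp
    ring

theorem binomialMass_le_mode {p : ℝ} (hp0 : 0 < p) (hp : p ≤ 1 / 2) {n k : ℕ}
    (h1 : (k : ℝ) ≤ (n + 1) * p) (h2 : (n + 1) * p ≤ k + 1) (m : ℕ) :
    binomialMass p n m ≤ binomialMass p n k := by
  have hnn := binomialMass_nonneg hp0.le (by linarith) n (p := p)
  have hkn : k ≤ n := by
    have : (k : ℝ) < n + 1 := by
      have : 0 < (n : ℝ) + 1 := by positivity
      nlinarith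
    exact Nat.lt_succ_iff.1 (by exact_mod_cast this)
  rcases le_total m k with h | h
  · induction h using Nat.decreasingInduction with
    | self => exact le_rfl
    | of_succ j hj ih =>
      refine le_trans ?_ ih
      have e := binomialMass_succ_right p (show j < n by omega)
      have hjk : (j : ℝ) + 1 ≤ k := by exact_mod_cast hj
      have hpos : 0 < ((j : ℝ) + 1) * (1 - p) := mul_pos (by positivity) (by linarith)
      refine le_of_mul_le_mul_right ?_ hpos
      calc binomialMass p n j * ((j + 1) * (1 - p)) ≤ binomialMass p n j * ((n - j) * p) :=
            mul_le_mul_of_nonneg_left (by nlinarith) (hnn j)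
        _ = _ := by linarith
  · induction m, h using Nat.le_induction with
    | base => exact le_rfl
    | succ j hj ih =>
      refine le_trans ?_ ih
      rcases lt_or_ge j n with hjn | hjn
      · have e := binomialMass_succ_right p hjn
        have hjk : (k : ℝ) ≤ j := by exact_mod_cast hj
        have hpos : 0 < ((j : ℝ) + 1) * (1 - p) := mul_pos (by positivity) (by linarith)
        refine le_of_mul_le_mul_right ?_ hpos
        calc binomialMass p n (j + 1) * ((j + 1) * (1 - p))
            = binomialMass p n j * ((n - j) * p) := by linarith
          _ ≤ _ := mul_le_mul_of_nonneg_left (by nlinarith) (hnn j)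
      · rw [binomialMass_eq_zero (by omega)]
        exact hnn j

theorem one_le_mul_binomialMass_mode {p : ℝ} {n k : ℕ}
    (h : ∀ m, binomialMass p n m ≤ binomialMass p n k) :
    1 ≤ ((n : ℝ) + 1) * binomialMass p n k := by
  calc (1 : ℝ) = ∑ m ∈ Finset.range (n + 1), binomialMass p n m := (sum_binomialMass p n).symm
    _ ≤ ∑ _m ∈ Finset.range (n + 1), binomialMass p n k := Finset.sum_le_sum fun m _ => h m
    _ = _ := by simp

/-! ### Expectations over binomial random subsets -/

section BernSum

variable {α : Type*} [DecidableEq α]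

/-- The expectation of `F S`, where `S` is a random subset of `V` that contains each element
independently with probability `p`. -/
noncomputable def bernSum (p : ℝ) (V : Finset α) (F : Finset α → ℝ) : ℝ :=
  ∑ S ∈ V.powerset, p ^ S.card * (1 - p) ^ (V \ S).card * F S

theorem bernSum_empty (p : ℝ) (F : Finset α → ℝ) : bernSum p ∅ F = F ∅ := by
  simp [bernSum]

theorem bernSum_insert (p : ℝ) {V : Finset α} {a : α} (ha : a ∉ V) (F : Finset α → ℝ) :
    bernSum p (insert a V) F
      = (1 - p) * bernSum p V F + p * bernSum p V fun S => F (insert a S) := by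
  unfold bernSum
  rw [Finset.sum_powerset_insert ha, Finset.mul_sum, Finset.mul_sum]
  congr 1
  · refine Finset.sum_congr rfl fun S hS => ?_
    have haS : a ∉ S := fun h => ha (Finset.mem_powerset.1 hS h)
    rw [Finset.insert_sdiff_of_notMem _ haS,
      Finset.card_insert_of_notMem (fun h => ha (Finset.mem_sdiff.1 h).1), pow_succ]
    ring
  · refine Finset.sum_congr rfl fun S hS => ?_
    have haS : a ∉ S := fun h => ha (Finset.mem_powerset.1 hS h)
    rw [Finset.card_insert_of_notMem haS, Finset.insert_sdiff_insert,
      Finset.sdiff_insert_of_notMem ha, pow_succ]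
    ring

theorem bernSum_const_mul (p : ℝ) (V : Finset α) (c : ℝ) (F : Finset α → ℝ) :
    bernSum p V (fun S => c * F S) = c * bernSum p V F := by
  simp only [bernSum, Finset.mul_sum]
  exact Finset.sum_congr rfl fun S _ => by ring

theorem bernSum_congr (p : ℝ) {V : Finset α} {F G : Finset α → ℝ}
    (h : ∀ S ⊆ V, F S = G S) : bernSum p V F = bernSum p V G :=
  Finset.sum_congr rfl fun S hS => by rw [h S (Finset.mem_powerset.1 hS)]

theorem bernSum_mono {p : ℝ} (hp0 : 0 ≤ p) (hp1 : p ≤ 1) {V : Finset α} {F G : Finset α → ℝ}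
    (h : ∀ S ⊆ V, F S ≤ G S) : bernSum p V F ≤ bernSum p V G := by
  have : 0 ≤ 1 - p := by linarith
  exact Finset.sum_le_sum fun S hS =>
    mul_le_mul_of_nonneg_left (h S (Finset.mem_powerset.1 hS)) (by positivity)

theorem bernSum_const (p : ℝ) (V : Finset α) (c : ℝ) : bernSum p V (fun _ => c) = c := by
  induction V using Finset.induction_on with
  | empty => simp [bernSum_empty]
  | insert a V ha ih =>
    rw [bernSum_insert p ha, ih]
    ring

theorem bernSum_union (p : ℝ) {X Y : Finset α} (h : Disjoint X Y) (F : Finset α → ℝ) :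
    bernSum p (X ∪ Y) F = bernSum p X fun A => bernSum p Y fun B => F (A ∪ B) := by
  induction X using Finset.induction_on generalizing F with
  | empty => simp [bernSum_empty]
  | insert a X ha ih =>
    rw [Finset.disjoint_insert_left] at h
    rw [Finset.insert_union, bernSum_insert p (by simp [ha, h.1]), bernSum_insert p ha,
      ih h.2, ih h.2]
    simp only [Finset.insert_union]

theorem bernSum_inter (p : ℝ) {V W : Finset α} (h : W ⊆ V) (F : Finset α → ℝ) :
    bernSum p V (fun S => F (S ∩ W)) = bernSum p W F := by
  have hd : Disjoint W (V \ W) := Finset.disjoint_sdiff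
  rw [← Finset.union_sdiff_of_subset h, bernSum_union p hd]
  refine bernSum_congr p fun A hA => ?_
  rw [← bernSum_const p (V \ W) (F A)]
  refine bernSum_congr p fun B hB => ?_
  congr 1
  ext x
  have h1 := @hA x
  have h2 := @hB x
  simp only [Finset.mem_sdiff, Finset.mem_inter, Finset.mem_union] at *
  tauto

theorem exp_neg_le_one_sub_half {x : ℝ} (h0 : 0 ≤ x) (h1 : x ≤ 1) :
    Real.exp (-x) ≤ 1 - x / 2 := by
  have h := Real.add_one_le_exp x
  have hpos := Real.exp_pos (-x)
  have hm : Real.exp (-x) * Real.exp x = 1 := by rw [← Real.exp_add]; simp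
  nlinarith

/-- The moment generating function bound behind the lower-tail Chernoff inequality. -/
theorem bernSum_exp_neg_sum_le {p : ℝ} (hp0 : 0 ≤ p) (hp1 : p ≤ 1) (V : Finset α) {w : α → ℝ}
    (hw0 : ∀ x ∈ V, 0 ≤ w x) (hw1 : ∀ x ∈ V, w x ≤ 1) :
    bernSum p V (fun S => Real.exp (-∑ x ∈ S, w x))
      ≤ Real.exp (-(p / 2 * ∑ x ∈ V, w x)) := by
  induction V using Finset.induction_on with
  | empty => simp [bernSum_empty]
  | insert a V ha ih =>
    have ih' := ih (fun x hx => hw0 x (Finset.mem_insert_of_mem hx))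
      fun x hx => hw1 x (Finset.mem_insert_of_mem hx)
    have hE : bernSum p V (fun S => Real.exp (-∑ x ∈ insert a S, w x))
        = Real.exp (-w a) * bernSum p V (fun S => Real.exp (-∑ x ∈ S, w x)) := by
      rw [← bernSum_const_mul]
      refine bernSum_congr p fun S hS => ?_
      rw [Finset.sum_insert fun h => ha (hS h), neg_add, Real.exp_add]
    rw [bernSum_insert p ha, hE, Finset.sum_insert ha, mul_add, neg_add, Real.exp_add]
    have h1 := exp_neg_le_one_sub_half (hw0 a (by simp)) (hw1 a (by simp))
    have h2 := Real.add_one_le_exp (-(p / 2 * w a))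
    have h3 : (1 - p) + p * Real.exp (-w a) ≤ Real.exp (-(p / 2 * w a)) := by nlinarith
    calc _ = ((1 - p) + p * Real.exp (-w a))
          * bernSum p V (fun S => Real.exp (-∑ x ∈ S, w x)) := by ring
      _ ≤ _ := mul_le_mul h3 ih' (Finset.sum_nonneg fun S _ => by
          have : 0 ≤ 1 - p := by linarith
          positivity) (Real.exp_pos _).le

/-! ### Comparison of uniform `k`-subsets with binomial random subsets -/

variable [Fintype α]

theorem card_filter_powersetCard_le {p : ℝ} (hp0 : 0 < p) (hp1 : p ≤ 1) {k : ℕ}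
    (hmode : ∀ m, binomialMass p (Fintype.card α) m ≤ binomialMass p (Fintype.card α) k)
    (P : Finset α → Prop) [DecidablePred P] :
    (((Finset.powersetCard k (Finset.univ : Finset α)).filter P).card : ℝ)
      ≤ (Fintype.card α).choose k
        * ((Fintype.card α + 1) * bernSum p Finset.univ fun S => if P S then 1 else 0) := by
  have h0 : 0 ≤ 1 - p := by linarith
  have h1 := one_le_mul_binomialMass_mode hmode
  set N := Fintype.card α with hN
  set c : ℝ := (((Finset.powersetCard k (Finset.univ : Finset α)).filter P).card : ℝ) with hc
  have h2 : c * (p ^ k * (1 - p) ^ (N - k))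
      ≤ bernSum p Finset.univ fun S => if P S then 1 else 0 := by
    unfold bernSum
    calc c * (p ^ k * (1 - p) ^ (N - k))
        = ∑ S ∈ (Finset.powersetCard k (Finset.univ : Finset α)).filter P,
          p ^ S.card * (1 - p) ^ (Finset.univ \ S).card * (if P S then 1 else 0) := by
          rw [hc, ← nsmul_eq_mul, ← Finset.sum_const]
          refine Finset.sum_congr rfl fun S hS => ?_
          simp only [Finset.mem_filter, Finset.mem_powersetCard] at hS
          rw [if_pos hS.2, mul_one, ← Finset.compl_eq_univ_sdiff, Finset.card_compl, hS.1.2]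
      _ ≤ _ := by
          refine Finset.sum_le_sum_of_subset_of_nonneg ?_ ?_
          · intro S _
            simp
          · intro S _ _
            split_ifs <;> positivity
  calc c = c * 1 := (mul_one c).symm
    _ ≤ c * ((N + 1) * binomialMass p N k) := mul_le_mul_of_nonneg_left h1 (by positivity)
    _ = N.choose k * ((N + 1) * (c * (p ^ k * (1 - p) ^ (N - k)))) := by
        unfold binomialMass; ring
    _ ≤ _ := by gcongr

theorem card_powersetCard_inter_eq_le (W A : Finset α) (k : ℕ) :
    ((Finset.powersetCard k (Finset.univ : Finset α)).filter fun S => S ∩ W = A).card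
      ≤ (Fintype.card α - W.card).choose (k - A.card) := by
  rw [← Finset.card_compl, ← Finset.card_powersetCard]
  refine Finset.card_le_card_of_injOn (fun S => S \ W) ?_ ?_
  · intro S hS
    simp only [Finset.coe_filter, Finset.mem_powersetCard, Set.mem_ofPred_eq] at hS
    obtain ⟨⟨-, hk⟩, rfl⟩ := hS
    simp only [Finset.mem_coe, Finset.mem_powersetCard]
    refine ⟨fun x hx => by simp_all, ?_⟩
    have := Finset.card_sdiff_add_card_inter S W
    omega
  · intro S hS T hT h
    simp only [Finset.coe_filter, Set.mem_ofPred_eq] at hS hT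
    rw [← Finset.sdiff_union_inter S W, ← Finset.sdiff_union_inter T W, hS.2, hT.2]
    exact congrArg (· ∪ A) h

theorem card_filter_powersetCard_inter_mul_le {p : ℝ} (hp0 : 0 < p) (hp : p ≤ 1 / 2) {k : ℕ}
    (hk : k ≤ Fintype.card α)
    (hmode : ∀ m, binomialMass p (Fintype.card α) m ≤ binomialMass p (Fintype.card α) k)
    (W : Finset α) (P : Finset α → Prop) [DecidablePred P] :
    (((Finset.powersetCard k (Finset.univ : Finset α)).filter fun S => P (S ∩ W)).card : ℝ)
        * ((Fintype.card α - W.card + 1) * (Fintype.card α - W.card + 2))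
      ≤ (Fintype.card α).choose k * ((Fintype.card α + 1) * (Fintype.card α + 2))
        * bernSum p W fun S => if P S then 1 else 0 := by
  have hW : W.card ≤ Fintype.card α := Finset.card_le_univ W
  set N := Fintype.card α with hN
  obtain ⟨n, hn⟩ : ∃ n, N = n + W.card := ⟨N - W.card, by omega⟩
  have hcast : (N : ℝ) - W.card = n := by rw [hn]; push_cast; ring
  have h0 : 0 < 1 - p := by linarith
  have hsum : ((Finset.powersetCard k (Finset.univ : Finset α)).filter fun S => P (S ∩ W)).card
      = ∑ A ∈ W.powerset.filter P,
        ((Finset.powersetCard k (Finset.univ : Finset α)).filter fun S => S ∩ W = A).card := by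
    rw [Finset.card_eq_sum_card_fiberwise (f := fun S => S ∩ W) (t := W.powerset.filter P)]
    · refine Finset.sum_congr rfl fun A hA => ?_
      congr 1
      ext S
      simp only [Finset.mem_filter] at *
      constructor
      · rintro ⟨⟨h1, -⟩, h3⟩
        exact ⟨h1, h3⟩
      · rintro ⟨h1, h3⟩
        exact ⟨⟨h1, h3 ▸ hA.2⟩, h3⟩
    · intro S hS
      simp only [Finset.coe_filter, Set.mem_ofPred_eq, Finset.mem_powerset] at *
      exact ⟨Finset.inter_subset_right, hS.2⟩
  have hterm : ∀ A ∈ W.powerset,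
      (((Finset.powersetCard k (Finset.univ : Finset α)).filter fun S => S ∩ W = A).card : ℝ)
        * ((n + 1) * (n + 2))
      ≤ N.choose k * ((N + 1) * (N + 2)) * (p ^ A.card * (1 - p) ^ (W \ A).card) := by
    intro A hA
    have hAW := Finset.mem_powerset.1 hA
    have hcA := Finset.card_le_card hAW
    have hrhs : 0 ≤ (N.choose k : ℝ) * ((N + 1) * (N + 2))
        * (p ^ A.card * (1 - p) ^ (W \ A).card) := by positivity
    have hle := card_powersetCard_inter_eq_le W A k
    rw [← hN, show N - W.card = n by omega] at hle
    by_cases hAk : A.card ≤ k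
    swap
    · have : ((Finset.powersetCard k (Finset.univ : Finset α)).filter fun S => S ∩ W = A) = ∅ := by
        refine Finset.filter_eq_empty_iff.2 fun S hS h => hAk ?_
        rw [← (Finset.mem_powersetCard.1 hS).2, ← h]
        exact Finset.card_le_card Finset.inter_subset_left
      rw [this]
      simpa using hrhs
    by_cases hkn : k - A.card ≤ n
    swap
    · rw [Nat.choose_eq_zero_of_lt (by omega), Nat.le_zero] at hle
      rw [hle]
      simpa using hrhs
    have hb := binomialMass_le_of_add hp0 hp (n := n) W.card (M := binomialMass p N k)
      (fun m => by rw [← hn]; exact hmode m) (k - A.card)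
    have hq : 0 < p ^ (k - A.card) * (1 - p) ^ (n - (k - A.card)) := by positivity
    refine le_of_mul_le_mul_right ?_ hq
    have hpow : p ^ k * (1 - p) ^ (N - k) = (p ^ A.card * (1 - p) ^ (W \ A).card)
        * (p ^ (k - A.card) * (1 - p) ^ (n - (k - A.card))) := by
      rw [Finset.card_sdiff_of_subset hAW, mul_mul_mul_comm, ← pow_add, ← pow_add]
      congr 2 <;> omega
    calc _ ≤ ((n.choose (k - A.card) : ℕ) : ℝ) * ((n + 1) * (n + 2))
            * (p ^ (k - A.card) * (1 - p) ^ (n - (k - A.card))) := by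
          gcongr
      _ = binomialMass p n (k - A.card) * ((n + 1) * (n + 2)) := by unfold binomialMass; ring
      _ ≤ _ := hb
      _ = N.choose k * ((N + 1) * (N + 2)) * (p ^ k * (1 - p) ^ (N - k)) := by
          unfold binomialMass
          rw [hn]
          push_cast
          ring
      _ = _ := by rw [hpow]; ring
  rw [hcast, hsum]
  push_cast
  unfold bernSum
  rw [Finset.sum_mul, Finset.mul_sum]
  simp only [mul_ite, mul_one, mul_zero]
  rw [← Finset.sum_filter]
  exact Finset.sum_le_sum fun A hA => hterm A (Finset.mem_filter.1 hA).1

/-- Restricted to a set `W` of `t` elements, a uniformly random `k`-subset of an `N`-element set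
is `O(t / N)`-close to a binomial random subset when `k` is the mode of `Bin(N, p)`. -/
theorem card_filter_powersetCard_inter_le {p : ℝ} (hp0 : 0 < p) (hp : p ≤ 1 / 2) {k : ℕ}
    (hk : k ≤ Fintype.card α)
    (hmode : ∀ m, binomialMass p (Fintype.card α) m ≤ binomialMass p (Fintype.card α) k)
    (W : Finset α) (P : Finset α → Prop) [DecidablePred P] :
    (((Finset.powersetCard k (Finset.univ : Finset α)).filter fun S => P (S ∩ W)).card : ℝ)
      ≤ (Fintype.card α).choose k
        * ((bernSum p W fun S => if P S then 1 else 0) + 2 * W.card / (Fintype.card α + 1)) := by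
  have h := card_filter_powersetCard_inter_mul_le hp0 hp hk hmode W P
  have hc : ((Finset.powersetCard k (Finset.univ : Finset α)).filter
      fun S => P (S ∩ W)).card ≤ (Fintype.card α).choose k :=
    (Finset.card_filter_le _ _).trans (by rw [Finset.card_powersetCard, Finset.card_univ])
  have hW : W.card ≤ Fintype.card α := Finset.card_le_univ W
  set c := ((Finset.powersetCard k (Finset.univ : Finset α)).filter fun S => P (S ∩ W)).card
  set e := bernSum p W fun S => if P S then 1 else 0
  generalize Fintype.card α = N at *
  generalize W.card = t at *
  have hc' : (c : ℝ) ≤ N.choose k := by exact_mod_cast hc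
  have hW' : (t : ℝ) ≤ N := by exact_mod_cast hW
  have hpos : 0 < ((N : ℝ) + 1) * (N + 2) := by positivity
  refine le_of_mul_le_mul_right ?_ hpos
  have hd : (N.choose k : ℝ) * (2 * t / (N + 1)) * ((N + 1) * (N + 2))
      = N.choose k * (2 * t * (N + 2)) := by field_simp
  have hloss : ((N : ℝ) + 1) * (N + 2) - (N - t + 1) * (N - t + 2) ≤ 2 * t * (N + 2) := by
    have : (0 : ℝ) ≤ t := by positivity
    nlinarith
  have h4 : (c : ℝ) * (((N : ℝ) + 1) * (N + 2) - (N - t + 1) * (N - t + 2))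
      ≤ N.choose k * (2 * t * (N + 2)) :=
    (mul_le_mul_of_nonneg_left hloss (by positivity)).trans
      (mul_le_mul_of_nonneg_right hc' (by positivity))
  rw [mul_add (N.choose k : ℝ), add_mul (_ * e), hd]
  linarith

end BernSum

/-! ### Edges of induced subgraphs -/

section Edges

open scoped Classical in
/-- The edges of `G` inside `S`, as increasing pairs of vertices. -/
noncomputable def edgePairs {n : ℕ} (G : SimpleGraph (Fin n)) (S : Finset (Fin n)) :
    Finset (Fin n × Fin n) :=
  (S ×ˢ S).filter fun q => q.1 < q.2 ∧ G.Adj q.1 q.2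

theorem mem_edgePairs {n : ℕ} {G : SimpleGraph (Fin n)} {S : Finset (Fin n)}
    {q : Fin n × Fin n} :
    q ∈ edgePairs G S ↔ (q.1 ∈ S ∧ q.2 ∈ S) ∧ q.1 < q.2 ∧ G.Adj q.1 q.2 := by
  simp [edgePairs]

theorem inducedEdges_eq_card_edgePairs {n : ℕ} (G : SimpleGraph (Fin n)) (S : Finset (Fin n)) :
    inducedEdges G S = (edgePairs G S).card := by
  unfold inducedEdges
  rw [← Set.ncard_coe_finset]
  symm
  refine Set.ncard_congr (fun q hq => s(⟨q.1, (mem_edgePairs.1 hq).1.1⟩,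
    ⟨q.2, (mem_edgePairs.1 hq).1.2⟩)) ?_ ?_ ?_
  · intro q hq
    exact (mem_edgePairs.1 hq).2.2
  · intro q r hq hr h
    have hq' := (mem_edgePairs.1 hq).2.1
    have hr' := (mem_edgePairs.1 hr).2.1
    simp only [Sym2.eq_iff, Subtype.mk.injEq] at h
    rcases h with h | h
    · exact Prod.ext h.1 h.2
    · rw [h.1, h.2] at hq'
      exact absurd hq' hr'.not_gt
  · intro e
    induction e using Sym2.ind with
    | _ a b =>
      intro h
      have hab : G.Adj a b := h
      rcases lt_or_gt_of_ne hab.ne with hlt | hlt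
      · exact ⟨(a, b), mem_edgePairs.2 ⟨⟨a.2, b.2⟩, hlt, hab⟩, rfl⟩
      · exact ⟨(b, a), mem_edgePairs.2 ⟨⟨b.2, a.2⟩, hlt, hab.symm⟩, Sym2.eq_swap⟩

theorem inducedEdges_inter_eq {n : ℕ} (G : SimpleGraph (Fin n)) {S W : Finset (Fin n)}
    (h : ∀ a ∈ S, ∀ b ∈ S, G.Adj a b → a ∈ W) :
    inducedEdges G (S ∩ W) = inducedEdges G S := by
  rw [inducedEdges_eq_card_edgePairs, inducedEdges_eq_card_edgePairs]
  congr 1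
  ext q
  simp only [mem_edgePairs, Finset.mem_inter]
  constructor
  · tauto
  · rintro ⟨⟨h1, h2⟩, h3, h4⟩
    exact ⟨⟨⟨h1, h _ h1 _ h2 h4⟩, h2, h _ h2 _ h1 h4.symm⟩, h3, h4⟩

open scoped Classical in
theorem sum_card_adj_le_inducedEdges {n : ℕ} (G : SimpleGraph (Fin n)) {X Y S : Finset (Fin n)}
    (hXY : Disjoint X Y) (hX : X ⊆ S) (hY : Y ⊆ S) :
    ∑ y ∈ Y, (X.filter (G.Adj y)).card ≤ inducedEdges G S := by
  rw [inducedEdges_eq_card_edgePairs, ← Finset.card_sigma]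
  have hne : ∀ x ∈ X, ∀ y ∈ Y, x ≠ y := fun x hx y hy h =>
    Finset.disjoint_left.1 hXY hx (h ▸ hy)
  refine Finset.card_le_card_of_injOn
    (fun q => if q.1 < q.2 then (q.1, q.2) else (q.2, q.1)) ?_ ?_
  · rintro ⟨y, x⟩ hq
    simp only [Finset.coe_sigma, Set.mem_sigma_iff, Finset.mem_coe, Finset.mem_filter] at hq
    obtain ⟨hy, hx, hadj⟩ := hq
    have := hne x hx y hy
    simp only [Finset.mem_coe, mem_edgePairs]
    split_ifs with hlt
    · exact ⟨⟨hY hy, hX hx⟩, hlt, hadj⟩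
    · exact ⟨⟨hX hx, hY hy⟩, lt_of_le_of_ne (not_lt.1 hlt) this, hadj.symm⟩
  · rintro ⟨y, x⟩ hq ⟨y', x'⟩ hq' h
    simp only [Finset.coe_sigma, Set.mem_sigma_iff, Finset.mem_coe, Finset.mem_filter] at hq hq'
    have h1 := hne x hq.2.1 y' hq'.1
    have h2 := hne x' hq'.2.1 y hq.1
    simp only at h
    split_ifs at h <;> simp only [Prod.mk.injEq] at h <;> obtain ⟨h3, h4⟩ := h
    · rw [h3, h4]
    · exact absurd h4 h1
    · exact absurd h4.symm h2
    · rw [h3, h4]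

open scoped Classical in
theorem card_filter_adj_le_inducedEdges {n : ℕ} (G : SimpleGraph (Fin n)) {S : Finset (Fin n)}
    {v : Fin n} (hv : v ∈ S) : (S.filter (G.Adj v)).card ≤ inducedEdges G S := by
  have h := sum_card_adj_le_inducedEdges G (X := S.filter (G.Adj v)) (Y := {v}) (S := S)
    (by simp) (Finset.filter_subset _ _) (by simpa using hv)
  simpa [Finset.filter_filter] using h

end Edges

/-! ### The edge polynomial -/

section EdgePolynomial

/-- The polynomial `∑ x_a x_b` over the edges `ab` of `G` inside `W`. -/
noncomputable def edgePolynomial {n : ℕ} (G : SimpleGraph (Fin n)) (W : Finset (Fin n)) :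
    MvPolynomial (Fin n) ℝ :=
  ∑ q ∈ edgePairs G W, MvPolynomial.X q.1 * MvPolynomial.X q.2

theorem isZeroOneQuadratic_edgePolynomial {n : ℕ} (G : SimpleGraph (Fin n))
    (W : Finset (Fin n)) : IsZeroOneQuadratic (edgePolynomial G W) where
  homogeneous := MvPolynomial.IsHomogeneous.sum _ _ _ fun q _ =>
    (MvPolynomial.isHomogeneous_X ℝ q.1).mul (MvPolynomial.isHomogeneous_X ℝ q.2)
  multilinear := by
    intro i
    refine (MvPolynomial.degreeOf_sum_le _ _ _).trans (Finset.sup_le fun q hq => ?_)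
    refine (MvPolynomial.degreeOf_mul_le _ _ _).trans ?_
    have hne := (mem_edgePairs.1 hq).2.1.ne
    rw [MvPolynomial.degreeOf_X, MvPolynomial.degreeOf_X]
    split_ifs with h1 h2
    · exact absurd (h1.symm.trans h2) hne
    all_goals norm_num
  coeff_mem := by
    classical
    intro m
    have hX : ∀ q : Fin n × Fin n, MvPolynomial.coeff m
        (MvPolynomial.X q.1 * MvPolynomial.X q.2 : MvPolynomial (Fin n) ℝ)
        = if Finsupp.single q.1 1 + Finsupp.single q.2 1 = m then 1 else 0 := by
      intro q
      rw [MvPolynomial.X, MvPolynomial.X, MvPolynomial.monomial_mul, MvPolynomial.coeff_monomial,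
        one_mul]
    unfold edgePolynomial
    rw [MvPolynomial.coeff_sum]
    simp only [hX]
    rw [Finset.sum_boole]
    have hle : ((edgePairs G W).filter fun q =>
        Finsupp.single q.1 1 + Finsupp.single q.2 1 = m).card ≤ 1 := by
      refine Finset.card_le_one.2 ?_
      rintro ⟨a, b⟩ h1 ⟨c, d⟩ h2
      rw [Finset.mem_filter, mem_edgePairs] at h1 h2
      obtain ⟨⟨-, hab, -⟩, e1⟩ := h1
      obtain ⟨⟨-, hcd, -⟩, e2⟩ := h2
      simp only at hab hcd e1 e2
      have hs : ∀ x y : Fin n, x < y →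
          (Finsupp.single x 1 + Finsupp.single y 1 : Fin n →₀ ℕ).support = {x, y} := by
        intro x y hxy
        ext z
        simp only [Finsupp.mem_support_iff, Finsupp.add_apply, Finsupp.single_apply,
          Finset.mem_insert, Finset.mem_singleton]
        split_ifs <;> simp_all [eq_comm]
      have hS : ({a, b} : Finset (Fin n)) = {c, d} := by
        rw [← hs a b hab, ← hs c d hcd, e1, e2]
      have ha : a ∈ ({c, d} : Finset (Fin n)) := hS ▸ by simp
      have hb : b ∈ ({c, d} : Finset (Fin n)) := hS ▸ by simp
      simp only [Finset.mem_insert, Finset.mem_singleton] at ha hb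
      rcases ha with rfl | rfl <;> rcases hb with rfl | rfl
      · exact absurd hab (lt_irrefl _)
      · rfl
      · exact absurd hab hcd.not_gt
      · exact absurd hab (lt_irrefl _)
    rcases Nat.le_one_iff_eq_zero_or_eq_one.1 hle with h | h <;> rw [h] <;> simp

theorem eval_edgePolynomial {n : ℕ} (G : SimpleGraph (Fin n)) (W S : Finset (Fin n)) :
    MvPolynomial.eval (fun i => if i ∈ S then (1 : ℝ) else 0) (edgePolynomial G W)
      = inducedEdges G (S ∩ W) := by
  unfold edgePolynomial
  rw [map_sum, inducedEdges_eq_card_edgePairs]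
  simp only [map_mul, MvPolynomial.eval_X, ← ite_and, mul_ite, mul_one, mul_zero]
  rw [Finset.sum_boole]
  congr 2
  ext q
  simp only [Finset.mem_filter, mem_edgePairs, Finset.mem_inter]
  tauto

theorem bernoulliVector_real_indicator {n : ℕ} (p : unitInterval) (S : Finset (Fin n)) :
    (bernoulliVector n p).real {fun i => if i ∈ S then (1 : ℝ) else 0}
      = (p : ℝ) ^ S.card * (1 - p) ^ (Finset.univ \ S).card := by
  unfold bernoulliVector
  rw [measureReal_def, Measure.pi_singleton, ENNReal.toReal_prod]
  have : ∀ i : Fin n, (ProbabilityTheory.bernoulliMeasure (1 : ℝ) 0 p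
      {if i ∈ S then (1 : ℝ) else 0}).toReal = if i ∈ S then (p : ℝ) else 1 - p := by
    intro i
    rw [← measureReal_def, ProbabilityTheory.bernoulliMeasure_real_apply p
      (measurableSet_singleton _)]
    split_ifs <;> simp_all
  rw [Finset.prod_congr rfl fun i _ => this i, Finset.prod_ite, Finset.prod_const,
    Finset.prod_const]
  congr 2
  · congr 1
    ext; simp
  · congr 1
    ext; simp

theorem bernSum_le_bernoulliPointProb {n : ℕ} (G : SimpleGraph (Fin n)) (W : Finset (Fin n))
    (p : unitInterval) (ℓ : ℕ) :
    (bernSum (p : ℝ) W fun S => if inducedEdges G S = ℓ then 1 else 0)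
      ≤ bernoulliPointProb (edgePolynomial G W) p ℓ := by
  classical
  rw [← bernSum_inter (p : ℝ) (Finset.subset_univ W)]
  unfold bernSum bernoulliPointProb
  simp only [mul_ite, mul_one, mul_zero]
  rw [← Finset.sum_filter]
  simp only [← bernoulliVector_real_indicator]
  have hinj : Set.InjOn (fun (S : Finset (Fin n)) i => if i ∈ S then (1 : ℝ) else 0)
      ((Finset.univ : Finset (Fin n)).powerset.filter fun S => inducedEdges G (S ∩ W) = ℓ) := by
    intro S _ T _ h
    ext i
    have := congrFun h i
    by_cases hS : i ∈ S <;> by_cases hT : i ∈ T <;> simp_all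
  have hprob : IsProbabilityMeasure (bernoulliVector n p) := by
    unfold bernoulliVector; infer_instance
  rw [← Finset.sum_image (f := fun x => (bernoulliVector n p).real {x}) hinj,
    sum_measureReal_singleton]
  refine measureReal_mono ?_
  intro x hx
  obtain ⟨S, hS, rfl⟩ := Finset.mem_image.1 (Finset.mem_coe.1 hx)
  simp only [Set.mem_ofPred_eq, eval_edgePolynomial]
  exact_mod_cast (Finset.mem_filter.1 hS).2

theorem bernSum_inducedEdges_le_sSup {n : ℕ} (G : SimpleGraph (Fin n)) (W : Finset (Fin n))
    (p : unitInterval) (ℓ : ℕ) :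
    (bernSum (p : ℝ) W fun S => if inducedEdges G S = ℓ then 1 else 0)
      ≤ sSup (bernoulliPointProbs p ℓ) :=
  (bernSum_le_bernoulliPointProb G W p ℓ).trans <|
    le_csSup (bernoulliPointProbs_bddAbove p ℓ)
      ⟨n, edgePolynomial G W, isZeroOneQuadratic_edgePolynomial G W, rfl⟩

end EdgePolynomial

/-! ### Lower-tail estimates for the number of induced edges -/

section LowerTail

open scoped Classical in
theorem bernSum_mem_inducedEdges_le {n : ℕ} (G : SimpleGraph (Fin n)) {p : ℝ} (hp0 : 0 ≤ p)
    (hp1 : p ≤ 1) (v : Fin n) (ℓ : ℕ) :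
    (bernSum p Finset.univ fun S => if v ∈ S ∧ inducedEdges G S = ℓ then 1 else 0)
      ≤ Real.exp (ℓ - p / 2 * (Finset.univ.filter (G.Adj v)).card) := by
  set w : Fin n → ℝ := fun x => if G.Adj v x then 1 else 0 with hw
  have hsum : ∀ S : Finset (Fin n), ∑ x ∈ S, w x = (S.filter (G.Adj v)).card := fun S => by
    simp [hw]
  calc _ ≤ bernSum p Finset.univ fun S => Real.exp ℓ * Real.exp (-∑ x ∈ S, w x) := by
        refine bernSum_mono hp0 hp1 fun S _ => ?_
        rw [← Real.exp_add]
        split_ifs with h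
        · have h1 := card_filter_adj_le_inducedEdges G h.1
          rw [h.2] at h1
          have h2 : ((S.filter (G.Adj v)).card : ℝ) ≤ ℓ := by exact_mod_cast h1
          rw [hsum]
          exact Real.one_le_exp (by linarith)
        · positivity
    _ = Real.exp ℓ * bernSum p Finset.univ fun S => Real.exp (-∑ x ∈ S, w x) :=
        bernSum_const_mul _ _ _ _
    _ ≤ Real.exp ℓ * Real.exp (-(p / 2 * ∑ x ∈ Finset.univ, w x)) := by
        gcongr
        refine bernSum_exp_neg_sum_le hp0 hp1 _ ?_ ?_ <;> intro x _ <;> simp only [hw] <;>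
          split_ifs <;> norm_num
    _ = _ := by rw [← Real.exp_add, hsum, ← sub_eq_add_neg]

open scoped Classical in
theorem exists_subset_crossing {n : ℕ} (G : SimpleGraph (Fin n)) (W : Finset (Fin n))
    (hW : ∀ a ∈ W, ∃ b ∈ W, G.Adj a b) :
    ∃ X ⊆ W, W.card ≤ 2 * ∑ x ∈ X, ((W \ X).filter (G.Adj x)).card := by
  obtain ⟨X, hX, hmax⟩ := Finset.exists_max_image
    (W.powerset.filter fun X => ∀ a ∈ X, ∀ b ∈ X, ¬ G.Adj a b) Finset.card
    ⟨∅, by simp⟩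
  simp only [Finset.mem_filter, Finset.mem_powerset] at hX hmax
  obtain ⟨hXW, hind⟩ := hX
  refine ⟨X, hXW, ?_⟩
  have h1 : X.card ≤ ∑ x ∈ X, ((W \ X).filter (G.Adj x)).card := by
    rw [Finset.card_eq_sum_ones]
    refine Finset.sum_le_sum fun x hx => Finset.card_pos.2 ?_
    obtain ⟨b, hb, hxb⟩ := hW x (hXW hx)
    exact ⟨b, by simpa [hb, hxb] using fun h => hind x hx b h hxb⟩
  have h2 : (W \ X).card ≤ ∑ y ∈ W \ X, (X.filter (G.Adj y)).card := by
    rw [Finset.card_eq_sum_ones]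
    refine Finset.sum_le_sum fun y hy => Finset.card_pos.2 ?_
    rw [Finset.mem_sdiff] at hy
    by_contra hne
    rw [Finset.not_nonempty_iff_eq_empty, Finset.filter_eq_empty_iff] at hne
    have := hmax (insert y X) ⟨Finset.insert_subset hy.1 hXW, by
      intro a ha b hb hab
      rw [Finset.mem_insert] at ha hb
      rcases ha with rfl | ha <;> rcases hb with rfl | hb
      · exact hab.ne rfl
      · exact hne hb hab
      · exact hne ha hab.symm
      · exact hind a ha b hb hab⟩
    rw [Finset.card_insert_of_notMem hy.2] at this
    omega
  have h3 : ∑ x ∈ X, ((W \ X).filter (G.Adj x)).card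
      = ∑ y ∈ W \ X, (X.filter (G.Adj y)).card := by
    have := Finset.sum_card_bipartiteAbove_eq_sum_card_bipartiteBelow (s := X) (t := W \ X) G.Adj
    simpa only [Finset.bipartiteAbove, Finset.bipartiteBelow, G.adj_comm] using this
  have h4 := Finset.card_sdiff_add_card_eq_card hXW
  omega

open scoped Classical in
theorem bernSum_inducedEdges_le {n : ℕ} (G : SimpleGraph (Fin n)) {p : ℝ} (hp0 : 0 ≤ p)
    (hp1 : p ≤ 1) (W : Finset (Fin n)) (hW : ∀ a ∈ W, ∃ b ∈ W, G.Adj a b) {D : ℝ} (hD : 0 < D)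
    (hdeg : ∀ a ∈ W, ((Finset.univ.filter (G.Adj a)).card : ℝ) ≤ D) {ℓ : ℕ} (hℓ : (ℓ : ℝ) ≤ D) :
    (bernSum p W fun S => if inducedEdges G S = ℓ then 1 else 0)
      ≤ Real.exp (1 - p ^ 2 * W.card / (8 * D)) := by
  obtain ⟨X, hXW, hcross⟩ := exists_subset_crossing G W hW
  set Y := W \ X with hY
  have hXY : Disjoint X Y := Finset.disjoint_sdiff
  have hdeg' : ∀ a ∈ W, ∀ Z : Finset (Fin n), ((Z.filter (G.Adj a)).card : ℝ) / D ≤ 1 := by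
    intro a ha Z
    rw [div_le_one hD]
    refine le_trans ?_ (hdeg a ha)
    exact_mod_cast Finset.card_le_card (Finset.filter_subset_filter _ (Finset.subset_univ Z))
  have hswap : ∀ A : Finset (Fin n), ∑ y ∈ Y, ((A.filter (G.Adj y)).card : ℝ) / D
      = ∑ x ∈ A, ((Y.filter (G.Adj x)).card : ℝ) / D := by
    intro A
    have := Finset.sum_card_bipartiteAbove_eq_sum_card_bipartiteBelow (s := Y) (t := A) G.Adj
    rw [← Finset.sum_div, ← Finset.sum_div]
    congr 1
    simp only [Finset.bipartiteAbove, Finset.bipartiteBelow] at this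
    rw [← Nat.cast_sum, this, Nat.cast_sum]
    simp only [G.adj_comm]
  calc _ = bernSum p X fun A => bernSum p Y fun B =>
        if inducedEdges G (A ∪ B) = ℓ then 1 else 0 := by
        rw [← bernSum_union p hXY fun S => if inducedEdges G S = ℓ then (1 : ℝ) else 0, hY,
          Finset.union_sdiff_of_subset hXW]
    _ ≤ bernSum p X fun A => bernSum p Y fun B =>
        Real.exp 1 * Real.exp (-∑ y ∈ B, ((A.filter (G.Adj y)).card : ℝ) / D) := by
        refine bernSum_mono hp0 hp1 fun A hA => bernSum_mono hp0 hp1 fun B hB => ?_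
        rw [← Real.exp_add]
        split_ifs with h
        · have h1 := sum_card_adj_le_inducedEdges G (X := A) (Y := B) (S := A ∪ B)
            (hXY.mono hA hB) Finset.subset_union_left Finset.subset_union_right
          rw [h] at h1
          have h2 : ∑ y ∈ B, ((A.filter (G.Adj y)).card : ℝ) ≤ ℓ := by exact_mod_cast h1
          have h3 : ∑ y ∈ B, ((A.filter (G.Adj y)).card : ℝ) / D ≤ 1 := by
            rw [← Finset.sum_div, div_le_one hD]
            exact h2.trans hℓ
          exact Real.one_le_exp (by linarith)
        · positivity
    _ ≤ bernSum p X fun A => Real.exp 1 *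
        Real.exp (-∑ x ∈ A, p / 2 * (((Y.filter (G.Adj x)).card : ℝ) / D)) := by
        refine bernSum_mono hp0 hp1 fun A hA => ?_
        rw [bernSum_const_mul, ← Finset.mul_sum, ← hswap]
        gcongr
        exact bernSum_exp_neg_sum_le hp0 hp1 _ (fun y _ => by positivity)
          fun y hy => hdeg' y (Finset.sdiff_subset hy) A
    _ ≤ Real.exp 1 *
        Real.exp (-(p / 2 * ∑ x ∈ X, p / 2 * (((Y.filter (G.Adj x)).card : ℝ) / D))) := by
        rw [bernSum_const_mul]
        gcongr
        refine bernSum_exp_neg_sum_le hp0 hp1 _ (fun y _ => by positivity) fun x hx => ?_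
        have h1 := hdeg' x (hXW hx) Y
        have h2 : 0 ≤ ((Y.filter (G.Adj x)).card : ℝ) / D := by positivity
        nlinarith
    _ ≤ _ := by
        rw [← Real.exp_add, Real.exp_le_exp, ← Finset.mul_sum, ← Finset.sum_div]
        have h1 : (W.card : ℝ) ≤ 2 * ∑ x ∈ X, ((Y.filter (G.Adj x)).card : ℝ) := by
          exact_mod_cast hcross
        have h2 : p ^ 2 * W.card / (8 * D)
            ≤ p ^ 2 * (2 * ∑ x ∈ X, ((Y.filter (G.Adj x)).card : ℝ)) / (8 * D) := by gcongr
        have h3 : ∀ s : ℝ, p / 2 * (p / 2 * (s / D)) = p ^ 2 * (2 * s) / (8 * D) := fun s => by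
          ring
        rw [h3]
        linarith

end LowerTail

/-! ### The bound for a fixed graph -/

section FixedGraph

open scoped Classical in
theorem card_edgeStatSets_le_add {n : ℕ} (G : SimpleGraph (Fin n)) (k ℓ : ℕ)
    (B W : Finset (Fin n)) (hW : ∀ a ∉ B, ∀ b ∉ B, G.Adj a b → a ∈ W) :
    (edgeStatSets G k ℓ).card
      ≤ ∑ v ∈ B, ((Finset.powersetCard k Finset.univ).filter
          fun S => v ∈ S ∧ inducedEdges G S = ℓ).card
        + ((Finset.powersetCard k Finset.univ).filter
          fun S => inducedEdges G (S ∩ W) = ℓ).card := by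
  refine le_trans ?_ (add_le_add_left Finset.card_biUnion_le _)
  refine le_trans (Finset.card_le_card ?_) (Finset.card_union_le _ _)
  intro S hS
  simp only [edgeStatSets, Finset.mem_filter] at hS
  simp only [Finset.mem_union, Finset.mem_biUnion, Finset.mem_filter]
  by_cases h : ∃ v ∈ B, v ∈ S
  · obtain ⟨v, hv, hvS⟩ := h
    exact Or.inl ⟨v, hv, hS.1, hvS, hS.2⟩
  · push Not at h
    refine Or.inr ⟨hS.1, ?_⟩
    rw [inducedEdges_inter_eq G fun a ha b hb => hW a (fun h' => h a h' ha) b fun h' => h b h' hb]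
    exact hS.2

theorem half_le_log {k : ℕ} (hk : 2 ≤ k) : 1 / 2 ≤ Real.log k := by
  have h : Real.log 2 ≤ Real.log k := Real.log_le_log (by norm_num) (by exact_mod_cast hk)
  have := Real.log_two_gt_d9
  linarith

open scoped Classical in
theorem sum_card_high_degree_le {n k ℓ : ℕ} (G : SimpleGraph (Fin n)) {p : ℝ} (hp0 : 0 < p)
    (hp : p ≤ 1 / 2) (hk : 1 ≤ k)
    (hn : ((n : ℝ) + 1) * p ≤ k + 1)
    (hmode : ∀ m, binomialMass p n m ≤ binomialMass p n k) (B : Finset (Fin n))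
    (hB : ∀ v ∈ B, 2 / p * (ℓ + 3 * Real.log k) ≤ (Finset.univ.filter (G.Adj v)).card) :
    ((∑ v ∈ B, ((Finset.powersetCard k Finset.univ).filter
        fun S => v ∈ S ∧ inducedEdges G S = ℓ).card : ℕ) : ℝ)
      ≤ n.choose k * (4 / p ^ 2 / k) := by
  have hk0 : (0 : ℝ) < k := by exact_mod_cast hk
  have hk1 : (1 : ℝ) ≤ k := by exact_mod_cast hk
  have hterm : ∀ v ∈ B, (((Finset.powersetCard k Finset.univ).filter
      fun S => v ∈ S ∧ inducedEdges G S = ℓ).card : ℝ)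
      ≤ n.choose k * ((n + 1) * (1 / (k : ℝ) ^ 3)) := by
    intro v hv
    have h1 := card_filter_powersetCard_le hp0 (by linarith) (k := k)
      (by simpa using hmode) (fun S : Finset (Fin n) => v ∈ S ∧ inducedEdges G S = ℓ)
    rw [Fintype.card_fin] at h1
    refine h1.trans ?_
    gcongr
    refine (bernSum_mem_inducedEdges_le G hp0.le (by linarith) v ℓ).trans ?_
    have h2 : p / 2 * (2 / p * (ℓ + 3 * Real.log k)) = ℓ + 3 * Real.log k := by field_simp
    have h3 := mul_le_mul_of_nonneg_left (hB v hv) (show 0 ≤ p / 2 by positivity)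
    calc _ ≤ Real.exp (-(3 * Real.log k)) := Real.exp_le_exp.2 (by linarith)
      _ = _ := by
        rw [Real.exp_neg, mul_comm, Real.exp_mul, Real.exp_log hk0, one_div]
        norm_cast
  have hn' : (n : ℝ) + 1 ≤ 2 * k / p := by
    rw [le_div_iff₀ hp0]
    linarith
  have hBn : (B.card : ℝ) ≤ n := by
    have := Finset.card_le_univ B
    rw [Fintype.card_fin] at this
    exact_mod_cast this
  push_cast
  calc _ ≤ ∑ v ∈ B, (n.choose k : ℝ) * ((n + 1) * (1 / (k : ℝ) ^ 3)) := Finset.sum_le_sum hterm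
    _ = n.choose k * (B.card * (n + 1) * (1 / (k : ℝ) ^ 3)) := by
        rw [Finset.sum_const, nsmul_eq_mul]; ring
    _ ≤ n.choose k * ((2 * k / p) * (2 * k / p) * (1 / (k : ℝ) ^ 3)) := by
        gcongr
        linarith
    _ = _ := by
        field_simp
        ring

open scoped Classical in
theorem card_inducedEdges_inter_le {n k ℓ : ℕ} (G : SimpleGraph (Fin n)) (p : unitInterval)
    (hp0 : 0 < (p : ℝ)) (hp : (p : ℝ) ≤ 1 / 2) (hk : 2 ≤ k) (hkn : k ≤ n) (hℓ : 1 ≤ ℓ)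
    (hn1 : (k : ℝ) ≤ (n + 1) * p) (hn2 : ((n : ℝ) + 1) * p ≤ k + 1)
    (hmode : ∀ m, binomialMass (p : ℝ) n m ≤ binomialMass p n k) (W : Finset (Fin n))
    (hW : ∀ a ∈ W, ∃ b ∈ W, G.Adj a b)
    (hdeg : ∀ a ∈ W, ((Finset.univ.filter (G.Adj a)).card : ℝ) ≤ 2 / p * (ℓ + 3 * Real.log k)) :
    (((Finset.powersetCard k Finset.univ).filter
        fun S => inducedEdges G (S ∩ W) = ℓ).card : ℝ)
      ≤ n.choose k * (sSup (bernoulliPointProbs p ℓ)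
        + 192 / (p : ℝ) ^ 2 * ((ℓ * Real.log k + Real.log k ^ 2) / k)) := by
  have hL := half_le_log hk
  have hk0 : (0 : ℝ) < k := by exact_mod_cast (by omega : 0 < k)
  have hk1 : (1 : ℝ) ≤ k := by exact_mod_cast (by omega : 1 ≤ k)
  have hℓ1 : (1 : ℝ) ≤ ℓ := by exact_mod_cast hℓ
  have hexp := Real.exp_log hk0
  set L := Real.log k
  set q : ℝ := (p : ℝ) with hq
  set D : ℝ := 2 / q * (ℓ + 3 * L) with hD
  have hD0 : 0 < D := by positivity
  have hsup := bernSum_inducedEdges_le_sSup G W p ℓ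
  have hinter := card_filter_powersetCard_inter_le hp0 hp (k := k) (by simpa using hkn)
    (by simpa using hmode) W (fun S => inducedEdges G S = ℓ)
  rw [Fintype.card_fin] at hinter
  rcases le_or_gt (W.card : ℝ) (16 * D * L / q ^ 2) with hT | hT
  · refine hinter.trans ?_
    gcongr
    calc 2 * (W.card : ℝ) / (n + 1) ≤ 2 * (16 * D * L / q ^ 2) / (k / q) := by
          gcongr
          rwa [div_le_iff₀ hp0]
      _ = 64 / q ^ 2 * ((ℓ * L + 3 * L ^ 2) / k) := by
          rw [hD]
          field_simp
          ring
      _ ≤ 64 / q ^ 2 * (3 * (ℓ * L + L ^ 2) / k) := by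
          gcongr
          nlinarith
      _ = _ := by ring
  · have hunif := card_filter_powersetCard_le hp0 (by linarith) (k := k)
      (by simpa using hmode) (fun S : Finset (Fin n) => inducedEdges G (S ∩ W) = ℓ)
    rw [Fintype.card_fin] at hunif
    refine hunif.trans ?_
    gcongr
    have hbs := bernSum_inter q (Finset.subset_univ W)
      (fun S => if inducedEdges G S = ℓ then (1 : ℝ) else 0)
    have hℓD : (ℓ : ℝ) ≤ D := by
      have h2 : 1 ≤ 2 / q := by
        rw [le_div_iff₀ hp0]
        linarith
      nlinarith
    have htail := bernSum_inducedEdges_le G hp0.le (by linarith) W hW hD0 hdeg hℓD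
    have hsup0 : 0 ≤ sSup (bernoulliPointProbs p ℓ) := by
      refine Real.sSup_nonneg ?_
      rintro _ ⟨s, f, -, rfl⟩
      exact measureReal_nonneg
    have hexp2 : Real.exp (1 - q ^ 2 * W.card / (8 * D)) ≤ 3 / (k : ℝ) ^ 2 := by
      have h1 : 2 * L ≤ q ^ 2 * W.card / (8 * D) := by
        rw [le_div_iff₀ (by positivity)]
        rw [div_lt_iff₀ (by positivity)] at hT
        linarith
      calc _ ≤ Real.exp (1 - 2 * L) := Real.exp_le_exp.2 (by linarith)
        _ = Real.exp 1 / (k : ℝ) ^ 2 := by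
          rw [Real.exp_sub, two_mul, Real.exp_add, hexp, sq]
        _ ≤ _ := by
          gcongr
          exact Real.exp_one_lt_three.le
    have hn' : (n : ℝ) + 1 ≤ 2 * k / q := by
      rw [le_div_iff₀ hp0]
      linarith
    have hLℓ : 1 / 2 ≤ ℓ * L + L ^ 2 := by nlinarith
    calc _ ≤ 2 * k / q * (3 / (k : ℝ) ^ 2) := by
          rw [hbs]
          refine (mul_le_mul_of_nonneg_left (htail.trans hexp2) (by positivity)).trans ?_
          gcongr
      _ = 12 / q * ((1 / 2) / k) := by
          field_simp
          ring
      _ ≤ 192 / q ^ 2 * ((ℓ * L + L ^ 2) / k) := by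
          gcongr
          · norm_num
          · nlinarith
      _ ≤ _ := by linarith

theorem card_edgeStatSets_le_sSup_add {n k ℓ : ℕ} (G : SimpleGraph (Fin n)) (p : unitInterval)
    (hp0 : 0 < (p : ℝ)) (hp : (p : ℝ) ≤ 1 / 2) (hk : 2 ≤ k) (hkn : k ≤ n) (hℓ : 1 ≤ ℓ)
    (hn1 : (k : ℝ) ≤ (n + 1) * p) (hn2 : ((n : ℝ) + 1) * p ≤ k + 1) :
    ((edgeStatSets G k ℓ).card : ℝ)
      ≤ n.choose k * (sSup (bernoulliPointProbs p ℓ)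
        + 200 / (p : ℝ) ^ 2 * ((ℓ * Real.log k + Real.log k ^ 2) / k)) := by
  classical
  have hmode := binomialMass_le_mode hp0 hp hn1 hn2
  set D : ℝ := 2 / (p : ℝ) * (ℓ + 3 * Real.log k)
  set B : Finset (Fin n) :=
    Finset.univ.filter fun v => D ≤ ((Finset.univ.filter (G.Adj v)).card : ℝ) with hB
  set W : Finset (Fin n) := Finset.univ.filter fun a => a ∉ B ∧ ∃ b, b ∉ B ∧ G.Adj a b with hWdef
  have hsplit := card_edgeStatSets_le_add G k ℓ B W fun a ha b hb hab => by
    rw [hWdef, Finset.mem_filter]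
    exact ⟨Finset.mem_univ a, ha, b, hb, hab⟩
  have hhigh := sum_card_high_degree_le G hp0 hp (by omega) hn2 hmode B (ℓ := ℓ)
    fun v hv => (Finset.mem_filter.1 hv).2
  have hlow := card_inducedEdges_inter_le G p hp0 hp hk hkn hℓ hn1 hn2 hmode W
    (fun a ha => by
      obtain ⟨-, haB, b, hb, hab⟩ := Finset.mem_filter.1 ha
      exact ⟨b, Finset.mem_filter.2 ⟨Finset.mem_univ b, hb, a, haB, hab.symm⟩, hab⟩)
    (fun a ha => by
      have := (Finset.mem_filter.1 ha).2.1
      rw [hB, Finset.mem_filter, not_and] at this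
      exact (not_le.1 (this (Finset.mem_univ a))).le)
  have hL := half_le_log hk
  have hk0 : (0 : ℝ) < k := by exact_mod_cast (by omega : 0 < k)
  have hℓ1 : (1 : ℝ) ≤ ℓ := by exact_mod_cast hℓ
  have hsmall : 4 / (p : ℝ) ^ 2 / k
      ≤ 8 / (p : ℝ) ^ 2 * ((ℓ * Real.log k + Real.log k ^ 2) / k) := by
    have : 4 / (p : ℝ) ^ 2 / k = 8 / (p : ℝ) ^ 2 * ((1 / 2) / k) := by ring
    rw [this]
    gcongr
    nlinarith
  have hsplit' : ((edgeStatSets G k ℓ).card : ℝ) ≤ _ := Nat.cast_le.2 hsplit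
  rw [Nat.cast_add] at hsplit'
  have hsmall' := mul_le_mul_of_nonneg_left hsmall (Nat.cast_nonneg (α := ℝ) (n.choose k))
  refine (hsplit'.trans (add_le_add hhigh hlow)).trans ?_
  refine (add_le_add_left hsmall' _).trans (le_of_eq ?_)
  ring

end FixedGraph

theorem edgeInducibility_le_div {n k : ℕ} (ℓ : ℕ) (hn : k ≤ n) :
    edgeInducibility k ℓ ≤ (maxEdgeStat n k ℓ : ℝ) / (n.choose k : ℝ) := by
  refine le_of_tendsto (tendsto_edgeInducibility k ℓ) ?_
  filter_upwards [eventually_ge_atTop n] with m hm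
  induction m, hm using Nat.le_induction with
  | base => exact le_rfl
  | succ m hm ih => exact (maxEdgeStat_div_choose_succ_le ℓ (hn.trans hm)).trans ih

theorem edgeInducibility_one_nonpos {ℓ : ℕ} (hℓ : 1 ≤ ℓ) : edgeInducibility 1 ℓ ≤ 0 := by
  refine (edgeInducibility_le_div ℓ le_rfl).trans (le_of_eq ?_)
  have : maxEdgeStat 1 1 ℓ = 0 := by
    refine Nat.le_zero.1 (Finset.sup_le fun G _ => ?_)
    rw [Nat.le_zero, Finset.card_eq_zero, Finset.eq_empty_iff_forall_notMem]
    intro S hS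
    have h := (Finset.mem_filter.1 hS).2
    rw [inducedEdges_eq_card_edgePairs] at h
    have : 0 < (edgePairs G S).card := by omega
    obtain ⟨q, hq⟩ := Finset.card_pos.1 this
    exact (mem_edgePairs.1 hq).2.1.ne (Subsingleton.elim _ _)
  simp [this]

theorem lemma6p1 (p : unitInterval) (hp0 : 0 < (p : ℝ)) (hp : (p : ℝ) ≤ 1 / 2) :
    ∃ C : ℝ, ∀ k ℓ : ℕ, 1 ≤ ℓ → ℓ ≤ k →
      edgeInducibility k ℓ ≤ sSup (bernoulliPointProbs p ℓ)
        + C * (((ℓ : ℝ) * Real.log (k : ℝ) + Real.log (k : ℝ) ^ 2) / (k : ℝ)) := by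
  refine ⟨200 / (p : ℝ) ^ 2, fun k ℓ hℓ hℓk => ?_⟩
  obtain rfl | hk : k = 1 ∨ 2 ≤ k := by omega
  · refine (edgeInducibility_one_nonpos hℓ).trans ?_
    simp only [Nat.cast_one, Real.log_one]
    norm_num
    refine Real.sSup_nonneg ?_
    rintro _ ⟨s, f, -, rfl⟩
    exact measureReal_nonneg
  have hk2 : (2 : ℝ) ≤ k := by exact_mod_cast hk
  -- Take `n` such that `k` is the mode of `Bin(n, p)`.
  obtain ⟨n, hn⟩ : ∃ n, ⌈(k : ℝ) / p⌉₊ = n + 1 :=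
    Nat.exists_eq_succ_of_ne_zero (Nat.ceil_pos.2 (by positivity)).ne'
  have hn1 : (k : ℝ) ≤ (n + 1) * p := by
    have := Nat.le_ceil ((k : ℝ) / p)
    rw [hn, div_le_iff₀ hp0] at this
    exact_mod_cast this
  have hn2 : ((n : ℝ) + 1) * p ≤ k + 1 := by
    have := Nat.ceil_lt_add_one (show 0 ≤ (k : ℝ) / p by positivity)
    rw [hn] at this
    push_cast at this
    have h := mul_lt_mul_of_pos_right this hp0
    rw [add_mul ((k : ℝ) / p) 1 (p : ℝ), div_mul_cancel₀ _ hp0.ne'] at h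
    linarith
  have hkn : k ≤ n := by
    have : (k : ℝ) ≤ n := by nlinarith
    exact_mod_cast this
  refine (edgeInducibility_le_div ℓ hkn).trans ?_
  have hc : (0 : ℝ) < n.choose k := by exact_mod_cast Nat.choose_pos hkn
  rw [div_le_iff₀ hc, mul_comm]
  obtain ⟨G, -, hG⟩ := Finset.exists_mem_eq_sup (Finset.univ : Finset (SimpleGraph (Fin n)))
    Finset.univ_nonempty fun G => (edgeStatSets G k ℓ).card
  rw [show maxEdgeStat n k ℓ = (edgeStatSets G k ℓ).card from hG]
  exact card_edgeStatSets_le_sSup_add G p hp0 hp hk hkn hℓ hn1 hn2
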